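/- A container is a pair $C=(S,P)$ consisting of a set $S$ of shapes and a family of sets $(P(s))_{s\in S}$ of positions. Its extension is the functor $[\![C]\!]:\mathbf{Set}\to\mathbf{Set}$ given by $[\![C]\!](X)=\sum_{s\in S}X^{P(s)}$, acting on maps by postcomposition. Let $\mathsf{Nest}$ be the class of codes freely generated by the grammar $$N \;::=\; \mathsf{Id}\;\mid\; K\,C\;\mid\; N+N'\;\mid\; N\times N'\;\mid\; N\circledast N',$$ where $C$ ranges over all containers. Each code $N$ is interpreted as an endofunctor $[\![N]\!]$ of the category $[\mathbf{Set},\mathbf{Set}]$ of functors $\mathbf{Set}\to\mathbf{Set}$ and natural transformations, defined by $$[\![\mathsf{Id}]\!]F=F,\qquad [\![K\,C]\!]F=[\![C]\!],\qquad [\![N+N']\!]F=[\![N]\!]F+[\![N']\!]F,$$ $$[\![N\times N']\!]F=[\![N]\!]F\times[\![N']\!]F,\qquad [\![N\circledast N']\!]F=[\![N]\!]F\circ[\![N']\!]F,$$ with coproducts, products and composition of functors, and with the evident action on natural transformations (for $\circledast$: horizontal composition). **Theorem.** For every code $N\in\mathsf{Nest}$, the endofunctor $[\![N]\!]$ of $[\mathbf{Set},\mathbf{Set}]$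 has an initial algebra $\mu[\![N]\!]$, and its underlying functor $\mathbf{Set}\to\mathbf{Set}$ is a container functor, i.e. it is naturally isomorphic to the extension $[\![C]\!]$ of some container $C$. -/

import Mathlib

open CategoryTheory

universe u

namespace NestedType

/-- A container `(S, P)`: a set `S` of shapes and a family `P : S → Set` of positions.
Mathlib's name for it is `PFunctor`, with `C.A` the shapes and `C.B` the positions. -/
abbrev Container : Type (u + 1) := PFunctor.{u, u}

/-- The extension of a container, `X ↦ Σ s : S, (P s → X)`, as a functor `Set ⥤ Set`. -/
def Container.ext (C : Container.{u}) : Type u ⥤ Type u where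
  obj X := Σ s : C.A, (C.B s → X)
  map f := ↾(fun x => ⟨x.1, fun p => f (x.2 p)⟩)

/-- The coproduct of two functors, `X ↦ F X + G X`. -/
def sumFunctor (F G : Type u ⥤ Type u) : Type u ⥤ Type u where
  obj X := F.obj X ⊕ G.obj X
  map f := ↾(Sum.map (F.map f) (G.map f))

/-- The coproduct of two natural transformations. -/
def sumMap {F F' G G' : Type u ⥤ Type u} (α : F ⟶ F') (β : G ⟶ G') :
    sumFunctor F G ⟶ sumFunctor F' G' where
  app X := ↾(Sum.map (α.app X) (β.app X))
  naturality X Y f := by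
    ext x
    rcases x with x | x
    · exact congrArg Sum.inl (NatTrans.naturality_apply α f x)
    · exact congrArg Sum.inr (NatTrans.naturality_apply β f x)

/-- The product of two functors, `X ↦ F X × G X`. -/
def prodFunctor (F G : Type u ⥤ Type u) : Type u ⥤ Type u where
  obj X := F.obj X × G.obj X
  map f := ↾(Prod.map (F.map f) (G.map f))

/-- The product of two natural transformations. -/
def prodMap {F F' G G' : Type u ⥤ Type u} (α : F ⟶ F') (β : G ⟶ G') :
    prodFunctor F G ⟶ prodFunctor F' G' where
  app X := ↾(Prod.map (α.app X) (β.app X))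
  naturality X Y f := by
    ext x
    exact congrArg₂ Prod.mk (NatTrans.naturality_apply α f x.1)
      (NatTrans.naturality_apply β f x.2)

/-- The grammar of nested types: `Id | K C | N + N' | N × N' | N ⊛ N'`, `C` any container. -/
inductive Nest : Type (u + 1) where
  /-- the identity functor on `Set ⥤ Set` -/
  | id : Nest
  /-- the constant functor at the extension of a container -/
  | K (C : Container.{u}) : Nest
  /-- coproduct -/
  | sum (N N' : Nest) : Nest
  /-- product -/
  | prod (N N' : Nest) : Nest
  /-- pointwise composition -/
  | comp (N N' : Nest) : Nest

/-- The action of the decoding of a code on functors `F : Set ⥤ Set`.  In the last clause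
`F ⋙ G` is "first `F`, then `G`", so `(N ⊛ N') F X = N F (N' F X)`. -/
def Nest.obj : Nest.{u} → (Type u ⥤ Type u) → (Type u ⥤ Type u)
  | .id, F => F
  | .K C, _ => C.ext
  | .sum N N', F => sumFunctor (N.obj F) (N'.obj F)
  | .prod N N', F => prodFunctor (N.obj F) (N'.obj F)
  | .comp N N', F => N'.obj F ⋙ N.obj F

/-- The action of the decoding of a code on natural transformations. -/
def Nest.map : (N : Nest.{u}) → {F G : Type u ⥤ Type u} → (F ⟶ G) → (N.obj F ⟶ N.obj G)
  | .id, _, _, α => α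
  | .K C, _, _, _ => 𝟙 C.ext
  | .sum N N', _, _, α => sumMap (N.map α) (N'.map α)
  | .prod N N', _, _, α => prodMap (N.map α) (N'.map α)
  | .comp N N', _, _, α => N'.map α ◫ N.map α

theorem Nest.map_id (N : Nest.{u}) (F : Type u ⥤ Type u) : N.map (𝟙 F) = 𝟙 (N.obj F) := by
  induction N with
  | id => rfl
  | K C => rfl
  | sum N N' ih ih' =>
    simp only [Nest.map, ih, ih']
    ext X x
    rcases x with x | x <;> rfl
  | prod N N' ih ih' =>
    simp only [Nest.map, ih, ih']
    ext X x
    rfl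
  | comp N N' ih ih' =>
    simp only [Nest.map, ih, ih']
    ext X x
    simp [Nest.obj]

theorem Nest.map_comp (N : Nest.{u}) {F G H : Type u ⥤ Type u} (α : F ⟶ G) (β : G ⟶ H) :
    N.map (α ≫ β) = N.map α ≫ N.map β := by
  induction N with
  | id => rfl
  | K C => rfl
  | sum N N' ih ih' =>
    simp only [Nest.map, ih, ih']
    ext X x
    rcases x with x | x <;> rfl
  | prod N N' ih ih' =>
    simp only [Nest.map, ih, ih']
    ext X x
    rfl
  | comp N N' ih ih' =>
    simp only [Nest.map, ih, ih']
    exact (NatTrans.exchange (N'.map α) (N'.map β) (N.map α) (N.map β)).symm ▸ rfl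

/-- The decoding `⟦N⟧` of a code `N`, an endofunctor of the category `Set ⥤ Set`. -/
def Nest.interp (N : Nest.{u}) : (Type u ⥤ Type u) ⥤ (Type u ⥤ Type u) where
  obj := N.obj
  map := N.map
  map_id := N.map_id
  map_comp := N.map_comp

/-- A functor `Set ⥤ Set` is a container functor if it is naturally isomorphic to the
extension of some container. -/
def IsContainerFunctor (F : Type u ⥤ Type u) : Prop :=
  ∃ C : Container.{u}, Nonempty (F ≅ C.ext)

end NestedType

/-!
The shapes and positions of a nested type have to be built simultaneously: in `N ⊛ N'` a shape
assigns a shape of `N'` to each position of a shape of `N`. This inductive-recursive definition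
becomes an ordinary inductive family once all position sets are taken among the subsets of one
fixed set `U`, because the shapes can then be indexed by their sets of positions. An infinite `U`
in which every position set of every container in the code embeds is large enough
(`Nest.exists_infinite_covered`): up to bijection its subsets are closed under binary sums, and
under sums of families indexed by another subset (`nonempty_sum_embedding`,
`nonempty_sigma_embedding`).

A family `T : Set U → Type u` of shapes has the container functor `X ↦ Σ V, T V × (V → X)`. By the
Yoneda lemma this construction, `extend U`, is left adjoint to the evaluation `G ↦ (V ↦ G V)` of
arbitrary functors at the subsets of `U` (`extendAdj`). Each code `N` acts on such families through
a polynomial functor `P`, given by an indexed container, with `extend U (P T) ≅ ⟦N⟧ (extend U T)`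
naturally in `T` (`nonempty_iso_ofNest`).

The initial `P`-algebra is the inductive family of well-founded trees (`isInitialTreeAlgebra`). A
left adjoint that intertwines two endofunctors sends initial algebras to initial algebras, because
it has a right adjoint on categories of algebras (`isInitialLeftAlgebra`). So the extension of the
family of trees, a container functor by construction, carries the initial `⟦N⟧`-algebra among all
functors, not just among container functors.
-/

namespace NestedType

/-! ### Initial algebras along a left adjoint -/

section Transfer

open Endofunctor

universe v₁ v₂ u₁ u₂

variable {C : Type u₁} [Category.{v₁} C] {D : Type u₂} [Category.{v₂} D]
  {L : C ⥤ D} {R : D ⥤ C} {P : C ⥤ C} {Q : D ⥤ D}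

/-- The `Q`-algebra structure on `L A` induced by a `P`-algebra structure on `A`, when `L`
intertwines `P` and `Q`. -/
def leftAlgebra (θ : P ⋙ L ≅ L ⋙ Q) (A : Algebra P) : Algebra Q where
  a := L.obj A.a
  str := θ.inv.app A.a ≫ L.map A.str

/-- The `P`-algebra structure on `R B` induced by a `Q`-algebra structure on `B`; its structure
map is the transpose of `L P R B ≅ Q L R B ⟶ Q B ⟶ B`. -/
def rightAlgebra (adj : L ⊣ R) (θ : P ⋙ L ≅ L ⋙ Q) (B : Algebra Q) : Algebra P where
  a := R.obj B.a
  str := adj.homEquiv _ _ (θ.hom.app (R.obj B.a) ≫ Q.map (adj.counit.app B.a) ≫ B.str)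

/-- A map `L A ⟶ B` is a `Q`-algebra map for the structure of `leftAlgebra` exactly when its
transpose `A ⟶ R B` is a `P`-algebra map for the structure of `rightAlgebra`. -/
theorem algebra_hom_transpose_iff (adj : L ⊣ R) (θ : P ⋙ L ≅ L ⋙ Q) {X : C} {Y : D}
    (a : P.obj X ⟶ X) (b : Q.obj Y ⟶ Y) (k : X ⟶ R.obj Y) :
    P.map k ≫ adj.homEquiv _ _ (θ.hom.app (R.obj Y) ≫ Q.map (adj.counit.app Y) ≫ b) = a ≫ k ↔
      Q.map ((adj.homEquiv _ _).symm k) ≫ b =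
        (θ.inv.app X ≫ L.map a) ≫ (adj.homEquiv _ _).symm k := by
  have hθ : L.map (P.map k) ≫ θ.hom.app (R.obj Y) = θ.hom.app X ≫ Q.map (L.map k) :=
    θ.hom.naturality k
  have hk : (adj.homEquiv _ _).symm k = L.map k ≫ adj.counit.app Y := adj.homEquiv_counit _ _ k
  rw [← (adj.homEquiv _ _).symm.injective.eq_iff]
  simp only [adj.homEquiv_naturality_left_symm, Equiv.symm_apply_apply, Category.assoc]
  rw [reassoc_of% hθ, hk, Q.map_comp, Category.assoc, ← Iso.app_inv, Iso.eq_inv_comp,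
    Iso.app_hom]

/-- A left adjoint intertwining `P` and `Q` carries an initial `P`-algebra to an initial
`Q`-algebra. -/
def isInitialLeftAlgebra (adj : L ⊣ R) (θ : P ⋙ L ≅ L ⋙ Q) {A : Algebra P}
    (hA : Limits.IsInitial A) : Limits.IsInitial (leftAlgebra θ A) :=
  Limits.IsInitial.ofUniqueHom
    (fun B =>
      { f := (adj.homEquiv _ _).symm (hA.to (rightAlgebra adj θ B)).f
        h := (algebra_hom_transpose_iff adj θ _ _ _).1 (hA.to (rightAlgebra adj θ B)).h })
    (fun B m => by
      ext
      let m' : L.obj A.a ⟶ B.a := m.f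
      have hm : Q.map m' ≫ B.str = (θ.inv.app A.a ≫ L.map A.str) ≫ m' := m.h
      let k : A ⟶ rightAlgebra adj θ B :=
        { f := adj.homEquiv _ _ m'
          h := (algebra_hom_transpose_iff adj θ _ _ _).2 (by rwa [Equiv.symm_apply_apply]) }
      have hk : k.f = (hA.to (rightAlgebra adj θ B)).f := by rw [hA.hom_ext k]
      exact (adj.homEquiv _ _).eq_symm_apply.2 hk)

end Transfer

/-! ### Sets of positions inside a fixed type -/

section Code

variable (U : Type u)

open Classical in
/-- A subset of `U` equipotent to `X`, provided that `X` embeds in `U`; the empty set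
otherwise. -/
noncomputable def code (X : Type u) : Set U :=
  if h : Nonempty (X ↪ U) then Set.range h.some else ∅

variable {U}

/-- The elements of `code U X` are in bijection with those of `X`. -/
noncomputable def codeEquiv {X : Type u} (h : Nonempty (X ↪ U)) : X ≃ code U X :=
  (Equiv.ofInjective h.some h.some.injective).trans
    (Equiv.setCongr (by rw [code, dif_pos h]))

theorem nonempty_sigma_embedding [Infinite U] (V : Set U) (W : V → Set U) :
    Nonempty ((Σ q : V, W q) ↪ U) := by
  have h : Cardinal.mk (U × U) = Cardinal.mk U := by
    rw [Cardinal.mk_prod, Cardinal.lift_id, Cardinal.mul_eq_self (Cardinal.aleph0_le_mk U)]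
  obtain ⟨e⟩ := Cardinal.eq.1 h
  refine ⟨⟨fun x => e (x.1, x.2), fun x y hxy => ?_⟩⟩
  obtain ⟨q, r⟩ := x
  obtain ⟨q', r'⟩ := y
  obtain ⟨h1, h2⟩ := Prod.mk.inj (e.injective hxy)
  obtain rfl := Subtype.ext h1
  obtain rfl := Subtype.ext h2
  rfl

theorem nonempty_sum_embedding [Infinite U] (V W : Set U) : Nonempty ((V ⊕ W : Type u) ↪ U) := by
  have h : Cardinal.mk (U ⊕ U) = Cardinal.mk U := by
    rw [Cardinal.mk_sum, Cardinal.lift_id, Cardinal.add_eq_self (Cardinal.aleph0_le_mk U)]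
  obtain ⟨e⟩ := Cardinal.eq.1 h
  exact ⟨((Function.Embedding.subtype _).sumMap (Function.Embedding.subtype _)).trans
    e.toEmbedding⟩

end Code

/-! ### Families of shapes and their left Kan extensions -/

/-- Families of sets indexed by the subsets of `U`; such a family records, for each set `V` of
positions, the set of shapes having `V` as positions. -/
abbrev Fam (U : Type u) : Type (u + 1) := Set U → Type u

/-- The container functor of a family of shapes, `X ↦ Σ V, T V × (V → X)`, functorially in the
family. -/
def extend (U : Type u) : Fam U ⥤ (Type u ⥤ Type u) where
  obj T := Container.ext ⟨Σ V, T V, fun x => x.1⟩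
  map f := { app := fun _ => ↾(fun x => ⟨⟨x.1.1, f x.1.1 x.1.2⟩, x.2⟩) }

/-- Evaluation of a functor at the subsets of `U`. -/
def restrict (U : Type u) : (Type u ⥤ Type u) ⥤ Fam U where
  obj G V := G.obj V
  map α V := α.app V

/-- Transformations out of the container functor of a family are determined by the generic
elements `⟨x, id⟩`: this is the Yoneda lemma, shape by shape. -/
def extendAdj (U : Type u) : extend U ⊣ restrict U :=
  Adjunction.mkOfHomEquiv
    { homEquiv := fun T G =>
        { toFun := fun α V => ↾(fun x => α.app V ⟨⟨V, x⟩, _root_.id⟩)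
          invFun := fun k =>
            { app := fun X => ↾(fun x => G.map (↾x.2) (k x.1.1 x.1.2))
              naturality := fun X Y f => by
                ext x
                exact types_congr_hom (G.map_comp (↾x.2) f) (k x.1.1 x.1.2) }
          left_inv := fun α => by
            ext X ⟨⟨V, x⟩, v⟩
            exact (NatTrans.naturality_apply α (↾v) ⟨⟨V, x⟩, _root_.id⟩).symm
          right_inv := fun k => by
            ext V x
            exact types_congr_hom (G.map_id V) (k V x) }
      homEquiv_naturality_left_symm := fun _ _ => rfl
      homEquiv_naturality_right := fun _ _ => rfl }

/-! ### Indexed containers and their initial algebras -/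

/-- A container indexed by the subsets of `U`, presenting a polynomial endofunctor of `Fam U`:
a shape `s` builds an element over `out s` from elements over `idx s p`, for all `p : Pos s`. -/
structure IndexedContainer (U : Type u) where
  /-- the shapes -/
  Sh : Type u
  /-- the index over which a shape builds an element -/
  out : Sh → Set U
  /-- the positions of a shape -/
  Pos : Sh → Type u
  /-- the index expected at a position -/
  idx : ∀ s, Pos s → Set U

namespace IndexedContainer

variable {U : Type u} (c : IndexedContainer U)

/-- The polynomial endofunctor of an indexed container on objects. -/
inductive Apply (T : Fam U) : Fam U
  | mk (s : c.Sh) (t : ∀ p : c.Pos s, T (c.idx s p)) : Apply T (c.out s)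

/-- The polynomial endofunctor of `Fam U` presented by an indexed container. -/
def functor : Fam U ⥤ Fam U where
  obj T := c.Apply T
  map f _ := ↾(fun x => match x with | .mk s t => .mk s (fun p => f _ (t p)))
  map_id T := by
    ext V x
    cases x
    rfl
  map_comp f g := by
    ext V x
    cases x
    rfl

/-- The well-founded trees of an indexed container. -/
inductive Tree : Fam U
  | mk (s : c.Sh) (t : ∀ p : c.Pos s, Tree (c.idx s p)) : Tree (c.out s)

/-- The algebra of well-founded trees. -/
def treeAlgebra : Endofunctor.Algebra c.functor where
  a := c.Tree
  str _ := ↾(fun x => match x with | .mk s t => .mk s t)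

variable {c}

/-- Recursion on well-founded trees. -/
def Tree.fold (B : Endofunctor.Algebra c.functor) : {V : Set U} → c.Tree V → B.a V
  | _, .mk s t => B.str _ (Apply.mk s (fun p => Tree.fold B (t p)))

variable (c)

/-- The algebra of well-founded trees is initial. -/
def isInitialTreeAlgebra : Limits.IsInitial c.treeAlgebra :=
  Limits.IsInitial.ofUniqueHom
    (fun B =>
      { f := fun _ => ↾(Tree.fold B)
        h := by
          ext V x
          cases x
          rfl })
    (fun B m => by
      ext V x
      change m.f V x = Tree.fold B x
      induction x with
      | mk s t ih =>
        have h := types_congr_hom (congrFun m.h _) (Apply.mk s t)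
        exact h.symm.trans (congrArg (fun t' => B.str _ (Apply.mk s t')) (funext ih)))

/-! ### Indexed containers for the codes -/

/-- `extend U (c.functor.obj T)` with the sum over `V` contracted: shapes are shapes `s` of `c`
filled with elements of `T`, and the positions are those of `c.out s`. -/
def flat (c : IndexedContainer U) : Fam U ⥤ (Type u ⥤ Type u) where
  obj T := Container.ext ⟨Σ s : c.Sh, ∀ p : c.Pos s, T (c.idx s p), fun x => c.out x.1⟩
  map f := { app := fun _ => ↾(fun x => ⟨⟨x.1.1, fun p => f _ (x.1.2 p)⟩, x.2⟩) }

/-- Contraction of the sum over the index. -/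
def functorExtendIso (c : IndexedContainer U) : c.functor ⋙ extend U ≅ c.flat :=
  NatIso.ofComponents (fun T => NatIso.ofComponents (fun X => Equiv.toIso
    { toFun := fun x => match x with | ⟨⟨_, .mk s t⟩, v⟩ => ⟨⟨s, t⟩, v⟩
      invFun := fun x => ⟨⟨_, .mk x.1.1 x.1.2⟩, x.2⟩
      left_inv := by rintro ⟨⟨_, ⟨s, t⟩⟩, v⟩; rfl
      right_inv := fun _ => rfl })
    (by intro X Y f; ext ⟨⟨_, ⟨s, t⟩⟩, v⟩; rfl))
    (by intro T T' f; ext X ⟨⟨_, ⟨s, t⟩⟩, v⟩; rfl)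

/-- The indexed container of the identity functor of `Fam U`: one shape for each index, with a
single position over the same index. -/
def id (U : Type u) : IndexedContainer U where
  Sh := Set U
  out V := V
  Pos _ := PUnit
  idx V _ := V

/-- The indexed container of the constant functor at `C.ext`: its shapes are leaves. It presents
that functor only if the position sets of `C` embed in `U`, since `code` takes the value `∅`
otherwise. -/
noncomputable def const (U : Type u) (C : Container.{u}) : IndexedContainer U where
  Sh := C.A
  out s := code U (C.B s)
  Pos _ := PEmpty
  idx _ := PEmpty.elim

/-- The coproduct of two indexed containers. -/
def sum (c d : IndexedContainer U) : IndexedContainer U where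
  Sh := c.Sh ⊕ d.Sh
  out := Sum.elim c.out d.out
  Pos := Sum.elim c.Pos d.Pos
  idx s := match s with
    | .inl s => c.idx s
    | .inr s => d.idx s

/-- The indexed container of the pointwise product of functors. The resulting position set is the
disjoint union, replaced by a subset of `U`. -/
noncomputable def prod (c d : IndexedContainer U) : IndexedContainer U where
  Sh := c.Sh × d.Sh
  out s := code U (c.out s.1 ⊕ d.out s.2)
  Pos s := c.Pos s.1 ⊕ d.Pos s.2
  idx s := Sum.elim (c.idx s.1) (d.idx s.2)

/-- The indexed container of the pointwise composition of functors: a shape of `c`, each of whose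
resulting positions carries a shape of `d`. The resulting position set is the sum of those of the
shapes of `d`, replaced by a subset of `U`. -/
noncomputable def comp (c d : IndexedContainer U) : IndexedContainer U where
  Sh := Σ s : c.Sh, c.out s → d.Sh
  out s := code U (Σ q : c.out s.1, d.out (s.2 q))
  Pos s := c.Pos s.1 ⊕ Σ q : c.out s.1, d.Pos (s.2 q)
  idx s := Sum.elim (c.idx s.1) (fun p => d.idx (s.2 p.1) p.2)

/-- The indexed container presenting a code. -/
noncomputable def ofNest (U : Type u) : Nest.{u} → IndexedContainer U
  | .id => id U
  | .K C => const U C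
  | .sum N N' => (ofNest U N).sum (ofNest U N')
  | .prod N N' => (ofNest U N).prod (ofNest U N')
  | .comp N N' => (ofNest U N).comp (ofNest U N')

end IndexedContainer

open IndexedContainer

/-! ### A type of positions large enough for a code -/

/-- Every position set of every container occurring in the code embeds in `U`. -/
def Nest.Covered (U : Type u) : Nest.{u} → Prop
  | .id => True
  | .K C => ∀ s, Nonempty (C.B s ↪ U)
  | .sum N N' => N.Covered U ∧ N'.Covered U
  | .prod N N' => N.Covered U ∧ N'.Covered U
  | .comp N N' => N.Covered U ∧ N'.Covered U

theorem Nest.Covered.trans {U V : Type u} (e : U ↪ V) {N : Nest.{u}} (h : N.Covered U) :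
    N.Covered V := by
  induction N with
  | id => trivial
  | K C => exact fun s => (h s).map (·.trans e)
  | sum N N' ih ih' => exact ⟨ih h.1, ih' h.2⟩
  | prod N N' ih ih' => exact ⟨ih h.1, ih' h.2⟩
  | comp N N' ih ih' => exact ⟨ih h.1, ih' h.2⟩

theorem Nest.exists_infinite_covered (N : Nest.{u}) :
    ∃ U : Type u, Infinite U ∧ N.Covered U := by
  -- for a code with two arguments, the disjoint union of the two types does
  have binary {M M' : Nest.{u}} (h : ∃ U : Type u, Infinite U ∧ M.Covered U)
      (h' : ∃ U : Type u, Infinite U ∧ M'.Covered U) :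
      ∃ U : Type u, Infinite U ∧ M.Covered U ∧ M'.Covered U := by
    obtain ⟨U, hU, hM⟩ := h
    obtain ⟨U', _, hM'⟩ := h'
    exact ⟨U ⊕ U', inferInstance, hM.trans .inl, hM'.trans .inr⟩
  induction N with
  | id => exact ⟨ULift ℕ, inferInstance, trivial⟩
  | K C =>
    exact ⟨(Σ s, C.B s) ⊕ ULift ℕ, inferInstance,
      fun s => ⟨(Function.Embedding.sigmaMk s).trans .inl⟩⟩
  | sum N N' ih ih' => exact binary ih ih'
  | prod N N' ih ih' => exact binary ih ih'
  | comp N N' ih ih' => exact binary ih ih'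

/-! ### Codes act on families as indexed containers -/

section Interp

variable {U : Type u}

theorem nonempty_iso_id : Nonempty ((IndexedContainer.id U).flat ≅ extend U ⋙ Nest.id.interp) :=
  ⟨NatIso.ofComponents (fun T => NatIso.ofComponents (fun X => Equiv.toIso
    { toFun := fun x => ⟨⟨x.1.1, x.1.2 ⟨⟩⟩, x.2⟩
      invFun := fun x => ⟨⟨x.1.1, fun _ => x.1.2⟩, x.2⟩
      left_inv := fun _ => rfl
      right_inv := fun _ => rfl })
    (by intro X Y f; rfl))
    (by intro T T' f; rfl)⟩

theorem nonempty_iso_const (C : Container.{u}) (h : ∀ s, Nonempty (C.B s ↪ U)) :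
    Nonempty ((const U C).flat ≅ extend U ⋙ (Nest.K C).interp) :=
  ⟨NatIso.ofComponents (fun T => NatIso.ofComponents (fun X => Equiv.toIso
    { toFun := fun x => ⟨x.1.1, fun p => x.2 (codeEquiv (h x.1.1) p)⟩
      invFun := fun x => ⟨⟨x.1, fun p => p.elim⟩, fun p => x.2 ((codeEquiv (h x.1)).symm p)⟩
      left_inv := by
        rintro ⟨⟨s, t⟩, v⟩
        refine Sigma.ext (Sigma.ext rfl (heq_of_eq (funext fun p => p.elim))) (heq_of_eq ?_)
        exact funext fun p => congrArg v ((codeEquiv (h s)).apply_symm_apply p)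
      right_inv := by
        rintro ⟨s, v⟩
        refine Sigma.ext rfl (heq_of_eq ?_)
        exact funext fun p => congrArg v ((codeEquiv (h s)).symm_apply_apply p) })
    (by intro X Y f; rfl))
    (by intro T T' f; rfl)⟩

theorem nonempty_iso_sum {c d : IndexedContainer U} {N N' : Nest.{u}}
    (e : c.flat ≅ extend U ⋙ N.interp) (e' : d.flat ≅ extend U ⋙ N'.interp) :
    Nonempty ((c.sum d).flat ≅ extend U ⋙ (N.sum N').interp) :=
  ⟨NatIso.ofComponents (fun T => NatIso.ofComponents (fun X => Equiv.toIso (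
      Equiv.trans (β := ((c.flat.obj T).obj X ⊕ (d.flat.obj T).obj X))
      { toFun := fun x => match x with
          | ⟨⟨.inl s, t⟩, v⟩ => .inl ⟨⟨s, t⟩, v⟩
          | ⟨⟨.inr s, t⟩, v⟩ => .inr ⟨⟨s, t⟩, v⟩
        invFun := fun x => match x with
          | .inl x => ⟨⟨.inl x.1.1, x.1.2⟩, x.2⟩
          | .inr x => ⟨⟨.inr x.1.1, x.1.2⟩, x.2⟩
        left_inv := by rintro ⟨⟨_ | _, t⟩, v⟩ <;> rfl
        right_inv := by rintro (_ | _) <;> rfl }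
      (Equiv.sumCongr ((e.app T).app X).toEquiv ((e'.app T).app X).toEquiv)))
    (by
      intro X Y f
      ext ⟨⟨s | s, t⟩, v⟩
      · exact congrArg Sum.inl (NatTrans.naturality_apply (e.hom.app T) f ⟨⟨s, t⟩, v⟩)
      · exact congrArg Sum.inr (NatTrans.naturality_apply (e'.hom.app T) f ⟨⟨s, t⟩, v⟩)))
    (by
      intro T T' f
      ext X ⟨⟨s | s, t⟩, v⟩
      · exact congrArg Sum.inl
          (types_congr_hom (NatTrans.congr_app (e.hom.naturality f) X) ⟨⟨s, t⟩, v⟩)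
      · exact congrArg Sum.inr
          (types_congr_hom (NatTrans.congr_app (e'.hom.naturality f) X) ⟨⟨s, t⟩, v⟩))⟩

/-- The product of the container functors presented by `c` and `d` is presented by `c.prod d`. -/
noncomputable def flatProdEquiv [Infinite U] (c d : IndexedContainer U) (T : Fam U) (X : Type u) :
    ((c.prod d).flat.obj T).obj X ≃ (c.flat.obj T).obj X × (d.flat.obj T).obj X :=
  let k (V W : Set U) := codeEquiv (nonempty_sum_embedding V W)
  { toFun := fun x =>
      (⟨⟨x.1.1.1, fun p => x.1.2 (.inl p)⟩, fun q => x.2 (k _ _ (.inl q))⟩,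
        ⟨⟨x.1.1.2, fun p => x.1.2 (.inr p)⟩, fun q => x.2 (k _ _ (.inr q))⟩)
    invFun := fun x =>
      ⟨⟨(x.1.1.1, x.2.1.1), fun p => match p with
          | .inl p => x.1.1.2 p
          | .inr p => x.2.1.2 p⟩,
        fun q => Sum.elim x.1.2 x.2.2 ((k _ _).symm q)⟩
    left_inv := by
      rintro ⟨⟨⟨s, s'⟩, t⟩, v⟩
      refine Sigma.ext (Sigma.ext rfl (heq_of_eq ?_)) (heq_of_eq ?_)
      · funext p
        cases p <;> rfl
      · funext q
        obtain ⟨q, rfl⟩ := (k _ _).surjective q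
        change Sum.elim _ _ ((k _ _).symm _) = _
        rw [Equiv.symm_apply_apply]
        cases q <;> rfl
    right_inv := by
      rintro ⟨⟨⟨s, t⟩, v⟩, ⟨⟨s', t'⟩, v'⟩⟩
      simp }

theorem nonempty_iso_prod [Infinite U] {c d : IndexedContainer U} {N N' : Nest.{u}}
    (e : c.flat ≅ extend U ⋙ N.interp) (e' : d.flat ≅ extend U ⋙ N'.interp) :
    Nonempty ((c.prod d).flat ≅ extend U ⋙ (N.prod N').interp) :=
  ⟨NatIso.ofComponents (fun T => NatIso.ofComponents (fun X => Equiv.toIso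
      ((flatProdEquiv c d T X).trans
        (Equiv.prodCongr ((e.app T).app X).toEquiv ((e'.app T).app X).toEquiv)))
    (by
      intro X Y f
      ext x
      exact congrArg₂ Prod.mk
        (NatTrans.naturality_apply (e.hom.app T) f (flatProdEquiv c d T X x).1)
        (NatTrans.naturality_apply (e'.hom.app T) f (flatProdEquiv c d T X x).2)))
    (by
      intro T T' f
      ext X x
      exact congrArg₂ Prod.mk
        (types_congr_hom (NatTrans.congr_app (e.hom.naturality f) X) (flatProdEquiv c d T X x).1)
        (types_congr_hom (NatTrans.congr_app (e'.hom.naturality f) X)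
          (flatProdEquiv c d T X x).2))⟩

/-- The composite of the container functors presented by `c` and `d` is presented by
`c.comp d`. -/
noncomputable def flatCompEquiv [Infinite U] (c d : IndexedContainer U) (T : Fam U) (X : Type u) :
    ((c.comp d).flat.obj T).obj X ≃ (c.flat.obj T).obj ((d.flat.obj T).obj X) :=
  let k (V : Set U) (W : V → Set U) := codeEquiv (nonempty_sigma_embedding V W)
  { toFun := fun x =>
      ⟨⟨x.1.1.1, fun p => x.1.2 (.inl p)⟩, fun q =>
        ⟨⟨x.1.1.2 q, fun p => x.1.2 (.inr ⟨q, p⟩)⟩, fun r => x.2 (k _ _ ⟨q, r⟩)⟩⟩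
    invFun := fun x =>
      ⟨⟨⟨x.1.1, fun q => (x.2 q).1.1⟩, fun p => match p with
          | .inl p => x.1.2 p
          | .inr p => (x.2 p.1).1.2 p.2⟩,
        fun r => (x.2 ((k _ _).symm r).1).2 ((k _ _).symm r).2⟩
    left_inv := by
      rintro ⟨⟨⟨s, w⟩, t⟩, v⟩
      refine Sigma.ext (Sigma.ext rfl (heq_of_eq ?_)) (heq_of_eq ?_)
      · funext p
        rcases p with p | p <;> rfl
      · funext r
        exact congrArg v ((k _ _).apply_symm_apply r)
    right_inv := by
      rintro ⟨⟨s, t⟩, v⟩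
      refine Sigma.ext rfl (heq_of_eq ?_)
      funext q
      refine Sigma.ext rfl (heq_of_eq ?_)
      funext r
      exact congrArg (fun z : Σ q, d.out (v q).1.1 => (v z.1).2 z.2)
        ((k _ _).symm_apply_apply ⟨q, r⟩) }

theorem nonempty_iso_comp [Infinite U] {c d : IndexedContainer U} {N N' : Nest.{u}}
    (e : c.flat ≅ extend U ⋙ N.interp) (e' : d.flat ≅ extend U ⋙ N'.interp) :
    Nonempty ((c.comp d).flat ≅ extend U ⋙ (N.comp N').interp) := by
  let E (T : Fam U) : (c.comp d).flat.obj T ≅ d.flat.obj T ⋙ c.flat.obj T :=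
    NatIso.ofComponents (fun X => (flatCompEquiv c d T X).toIso) (by intro X Y f; rfl)
  refine ⟨NatIso.ofComponents (fun T => E T ≪≫ NatIso.hcomp (e'.app T) (e.app T)) ?_⟩
  intro T T' f
  have hE : (c.comp d).flat.map f ≫ (E T').hom = (E T).hom ≫ (d.flat.map f ◫ c.flat.map f) := rfl
  let a (T : Fam U) : c.flat.obj T ⟶ N.obj ((extend U).obj T) := e.hom.app T
  let a' (T : Fam U) : d.flat.obj T ⟶ N'.obj ((extend U).obj T) := e'.hom.app T
  have ha : c.flat.map f ≫ a T' = a T ≫ N.map ((extend U).map f) := e.hom.naturality f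
  have ha' : d.flat.map f ≫ a' T' = a' T ≫ N'.map ((extend U).map f) := e'.hom.naturality f
  change (c.comp d).flat.map f ≫ (E T').hom ≫ (a' T' ◫ a T') =
    ((E T).hom ≫ (a' T ◫ a T)) ≫ (N'.map ((extend U).map f) ◫ N.map ((extend U).map f))
  rw [reassoc_of% hE, ← NatTrans.exchange, ha, ha', NatTrans.exchange, Category.assoc]

/-- On container functors of families of shapes, the endofunctor denoted by a code is given by the
indexed container of the code. -/
theorem nonempty_iso_ofNest [Infinite U] (N : Nest.{u}) (h : N.Covered U) :
    Nonempty ((ofNest U N).flat ≅ extend U ⋙ N.interp) := by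
  induction N with
  | id => exact nonempty_iso_id
  | K C => exact nonempty_iso_const C h
  | sum N N' ih ih' =>
    obtain ⟨e⟩ := ih h.1
    obtain ⟨e'⟩ := ih' h.2
    exact nonempty_iso_sum e e'
  | prod N N' ih ih' =>
    obtain ⟨e⟩ := ih h.1
    obtain ⟨e'⟩ := ih' h.2
    exact nonempty_iso_prod e e'
  | comp N N' ih ih' =>
    obtain ⟨e⟩ := ih h.1
    obtain ⟨e'⟩ := ih' h.2
    exact nonempty_iso_comp e e'

end Interp

end NestedType

theorem mainTheorem4 (N : NestedType.Nest.{u}) :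
    ∃ A : Endofunctor.Algebra N.interp,
      Nonempty (Limits.IsInitial A) ∧ NestedType.IsContainerFunctor A.a := by
  obtain ⟨U, _, hU⟩ := N.exists_infinite_covered
  obtain ⟨e⟩ := NestedType.nonempty_iso_ofNest N hU
  let c := NestedType.IndexedContainer.ofNest U N
  exact ⟨NestedType.leftAlgebra (c.functorExtendIso ≪≫ e) c.treeAlgebra,
    ⟨NestedType.isInitialLeftAlgebra (NestedType.extendAdj U) _ c.isInitialTreeAlgebra⟩,
    -- the carrier is by definition the extension of this container
    ⟨Σ V, c.Tree V, fun x => x.1⟩, ⟨Iso.refl _⟩⟩
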